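/- Consider a single-server FIFO queue, initially empty at time $0$, with i.i.d. service times $S_1,S_2,\dots\ge 0$ of mean $1/\mu$, $0<\mu<\infty$, either in continuous time (all times are reals) or in discrete time (all times are integers). If packets arrive at times $0\le a_1\le\dots\le a_n$, the departure times are $d_i=\max\{a_i,d_{i-1}\}+S_i$, with $d_0=0$. An $(n,M,T,\epsilon)$-code (without feedback) consists of $M$ codewords, each a vector $0\le a_1\le\dots\le a_n$ of arrival times, and a measurable decoder that estimates the message $u\in\{1,\dots,M\}$ from $d^n=(d_1,\dots,d_n)$, such that, over equiprobable messages and the service times, $\mathbb E[d_n]\le T$ and $\mathbb P(\hat u\ne u)\le\epsilon$. For $\lambda>0$ let $C(\lambda)$ be the supremum of all $R$ such that for every $\gamma>0$ there is a sequence of $(n,M,n/\lambda,\epsilon)$-codes with $n\to\infty$, $\epsilon\to0$ and $\lambda\,\frac{\log_2 M}{n}>R-\gamma$. Then, for $0<\lambda<\mu$, $$C(\lambda)\;\le\;\lambda\sup_{X:\ \mathbb E[(X-S_1)^+]\le \frac1\lambda-\frac1\mu} I\big((X-S_1)^+;\,(X-S_1)^++S_2\big),$$ where $S_1,S_2$ are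 independent and follow the service time distribution, $X$ is an arbitrary real (in discrete time: integer-valued) random variable independent of $(S_1,S_2)$, and the mutual information $I$, possibly infinite, is in bits. Moreover this bound is at most $$\lambda\sup_{W\ge 0,\ \mathbb E[W]\le\frac1\lambda-\frac1\mu} I(W;W+S),$$ the single-letter feedback-capacity bound, where $S$ follows the service time distribution and $W$ (integer-valued in discrete time) is independent of $S$. -/

import Mathlib

open MeasureTheory Filter Topology
open scoped ENNReal

/-- The two settings of the queue: time is discrete (slots) or continuous. -/
inductive TimeModel where
  | discrete
  | continuous

/-- The admissible time values: all integers in discrete time, all reals in continuous time. -/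
def TimeModel.times : TimeModel → Set ℝ
  | .discrete => Set.range (fun k : ℤ => (k : ℝ))
  | .continuous => Set.univ

/-- `ν` is a possible service time distribution of service rate `mu` (mean `1 / mu`). -/
structure IsServiceLaw (model : TimeModel) (mu : ℝ) (ν : Measure ℝ) : Prop where
  isProbability : IsProbabilityMeasure ν
  nonneg : ∀ᵐ s ∂ν, 0 ≤ s
  mem_times : ∀ᵐ s ∂ν, s ∈ model.times
  mean : ∫⁻ s, ENNReal.ofReal s ∂ν = ENNReal.ofReal (1 / mu)

/-- `departureTime a s i` is the departure time of the `i`-th packet (`1 ≤ i ≤ n`) of the initially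
empty single-server FIFO queue, for nonnegative arrival times `a` and service times `s`.
The vectors are indexed from `0`, so that the packet number `i + 1` arrives at `a i`, starts being
served at the later of `a i` and the previous departure, and is served during `s i`.
The value at `0` is the time origin. -/
noncomputable def departureTime {n : ℕ} (a s : Fin n → ℝ) : ℕ → ℝ
  | 0 => 0
  | i + 1 => if h : i < n then max (a ⟨i, h⟩) (departureTime a s i) + s ⟨i, h⟩
      else departureTime a s i

/-- The vector of the `n` departure times. -/
noncomputable def departures {n : ℕ} (a s : Fin n → ℝ) : Fin n → ℝ :=
  fun i => departureTime a s (i + 1)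

/-- A code without feedback for `n` packets and `M` messages: each message has a codeword, which
is a nondecreasing vector of `n` nonnegative arrival instants, and the decoder estimates the
message from the `n` departure times. -/
structure TimingCode (model : TimeModel) (n M : ℕ) where
  arrival : Fin M → Fin n → ℝ
  arrival_nonneg : ∀ u i, 0 ≤ arrival u i
  arrival_mem_times : ∀ u i, arrival u i ∈ model.times
  arrival_mono : ∀ u, Monotone (arrival u)
  decoder : (Fin n → ℝ) → Fin M
  measurable_decoder : Measurable decoder

namespace TimingCode

variable {model : TimeModel} {n M : ℕ}

/-- The expected time of the `n`-th departure, over equiprobable messages and i.i.d. service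
times of law `ν`. -/
noncomputable def meanLastDeparture (c : TimingCode model n M) (ν : Measure ℝ) : ℝ≥0∞ :=
  (∑ u : Fin M, ∫⁻ s, ENNReal.ofReal (departureTime (c.arrival u) s n)
    ∂(Measure.pi fun _ : Fin n => ν)) / M

/-- The average decoding error probability, over equiprobable messages and i.i.d. service times
of law `ν`. -/
noncomputable def errorProb (c : TimingCode model n M) (ν : Measure ℝ) : ℝ :=
  (∑ u : Fin M, (Measure.pi fun _ : Fin n => ν).real
    {s | c.decoder (departures (c.arrival u) s) ≠ u}) / M

/-- `c` is an `(n, M, T, ε)`-code for the queue with service law `ν`. -/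
def IsCode (c : TimingCode model n M) (ν : Measure ℝ) (T ε : ℝ) : Prop :=
  c.meanLastDeparture ν ≤ ENNReal.ofReal T ∧ c.errorProb ν ≤ ε

end TimingCode

/-- The rate `R` (bits per unit of time) is achievable without feedback at output rate `lam`:
for every `γ > 0` there is a sequence of `(n, M, n / lam, ε)`-codes, with `n → ∞` and `ε → 0`,
such that `lam * log₂ M / n > R - γ`. -/
def IsAchievableAt (model : TimeModel) (ν : Measure ℝ) (lam R : ℝ) : Prop :=
  ∀ γ : ℝ, 0 < γ → ∃ (n M : ℕ → ℕ) (ε : ℕ → ℝ) (c : ∀ k, TimingCode model (n k) (M k)),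
    Tendsto n atTop atTop ∧ Tendsto ε atTop (𝓝 0) ∧
    ∀ k, (c k).IsCode ν (n k / lam) (ε k) ∧ R - γ < lam * (Real.logb 2 (M k) / n k)

/-- The capacity without feedback at output rate `lam`: the supremum of the achievable rates. -/
noncomputable def capacityAt (model : TimeModel) (ν : Measure ℝ) (lam : ℝ) : ℝ≥0∞ :=
  ⨆ (R : ℝ) (_ : IsAchievableAt model ν lam R), ENNReal.ofReal R

/-- The mutual information `I(X; Y)` in bits, for arbitrary real random variables: the relative
entropy of the joint law with respect to the product of the marginals (possibly infinite). -/
noncomputable def mutualInfo {Ω : Type*} [MeasurableSpace Ω] (P : Measure Ω) (X Y : Ω → ℝ) :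
    ℝ≥0∞ :=
  InformationTheory.klDiv (P.map fun ω => (X ω, Y ω)) ((P.map X).prod (P.map Y)) /
    ENNReal.ofReal (Real.log 2)

/-- `I(W(X); W(X) + S₂)` for `W(X) = (X - S₁)⁺`, with `X`, `S₁`, `S₂` independent, `X` of law `ρ`
and `S₁`, `S₂` of law `ν`: the three variables are the coordinates on the product space. -/
noncomputable def infoNoFeedback (ν ρ : Measure ℝ) : ℝ≥0∞ :=
  mutualInfo (ρ.prod (ν.prod ν)) (fun ω : ℝ × ℝ × ℝ => max (ω.1 - ω.2.1) 0)
    (fun ω : ℝ × ℝ × ℝ => max (ω.1 - ω.2.1) 0 + ω.2.2)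

/-- `E[W(X)]` for `W(X) = (X - S₁)⁺`, with `X`, `S₁` independent of laws `ρ`, `ν`. -/
noncomputable def meanWait (ν ρ : Measure ℝ) : ℝ≥0∞ :=
  ∫⁻ ω : ℝ × ℝ, ENNReal.ofReal (max (ω.1 - ω.2) 0) ∂(ρ.prod ν)

/-- The supremum of `I((X - S₁)⁺; (X - S₁)⁺ + S₂)` over all (time-valued) random variables `X`
independent of `(S₁, S₂)` with `E[(X - S₁)⁺] ≤ a`. It only depends on the law `ρ` of `X`. -/
noncomputable def supInfoNoFeedback (model : TimeModel) (ν : Measure ℝ) (a : ℝ) : ℝ≥0∞ :=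
  ⨆ (ρ : Measure ℝ) (_ : IsProbabilityMeasure ρ) (_ : ∀ᵐ x ∂ρ, x ∈ model.times)
    (_ : meanWait ν ρ ≤ ENNReal.ofReal a), infoNoFeedback ν ρ

/-- The supremum of `I(W; W + S)` over all (time-valued) random variables `W ≥ 0` independent of
`S` with `E[W] ≤ a`. It only depends on the law `ρ` of `W`. -/
noncomputable def supInfoFeedback (model : TimeModel) (ν : Measure ℝ) (a : ℝ) : ℝ≥0∞ :=
  ⨆ (ρ : Measure ℝ) (_ : IsProbabilityMeasure ρ) (_ : ∀ᵐ w ∂ρ, w ∈ model.times)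
    (_ : ∀ᵐ w ∂ρ, 0 ≤ w) (_ : ∫⁻ w, ENNReal.ofReal w ∂ρ ≤ ENNReal.ofReal a),
    mutualInfo (ρ.prod ν) (fun ω : ℝ × ℝ => ω.1) (fun ω : ℝ × ℝ => ω.1 + ω.2)

/-!
The departures of the queue are driven by the idle times `W i = (a i - D (i - 1))⁺` of the server:
the interdeparture times are `Y i = W i + S i`, where `S i` is independent of `W i`. Since the
preceding packet departs at `D (i - 1) = max (a (i - 1)) (D (i - 2)) + S (i - 1)`, the idle time is
`W i = (X i - S (i - 1))⁺`, where `X i = a i - max (a (i - 1)) (D (i - 2))` does not depend on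
`S (i - 1)` and `S i` (`exists_waitLaw_eq_map_idleTime`). So each packet uses the channel
`W ↦ W + S` with an input of the form `(X - S)⁺`, and the total idle time is bounded by the
constraint on the last departure.

Let `ρ` be the mixture of the laws of all the `X i`, over the packets and the messages, and let `η`
be the law of the output of the channel for this mixture. The law of the interdeparture times of
each message is compared with the product law `η ^ n` through the product of the likelihood ratios
of the single packets (`lintegral_mul_prod_le_lintegral_pi`). The mean of the logarithm of this
product, averaged over the messages, is `n` times the mutual information for `ρ`
(`exists_inverse_likelihoodRatio_mixture`). Under `η ^ n` the decoder succeeds with average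
probability `1 / M`, and `x ≤ exp x - 1` gives a form of Fano's inequality
(`log_mul_measureReal_le`, `log_mul_sum_le`).

The first packet has no predecessor, and its idle time need not be of the form `(X - S)⁺`: its
information might even be infinite for an unrestricted input. To get around this, a
preliminary packet is sent at time `0`, and the codewords are delayed by `m = √n`
(`TimingCode.prepend`). The preliminary packet itself has idle time `0 = (0 - S)⁺`. This costs the
error probability `P(S > m)`, which vanishes, and a slight excess of the mean idle time per packet,
from `a` to `b` say. Mixing `ρ` with the law of `X = 0`, whose idle time is `0`, restores the
constraint and costs a factor `b / a`, which tends to `1`.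

The comparison with feedback holds because `(X - S₁)⁺` is an admissible input of the channel.
-/

/-! ### The recursion of the queue -/

/-- The time during which the server is idle between the departure of the previous packet and the
arrival of packet `i`, which is `0` if that packet finds the server busy. -/
noncomputable def idleTime {n : ℕ} (a s : Fin n → ℝ) (i : Fin n) : ℝ :=
  max (a i - departureTime a s i) 0

/-- The time between two consecutive departures: the idle time followed by the service time. -/
noncomputable def interdeparture {n : ℕ} (a s : Fin n → ℝ) (i : Fin n) : ℝ :=
  idleTime a s i + s i

lemma idleTime_nonneg {n : ℕ} (a s : Fin n → ℝ) (i : Fin n) : 0 ≤ idleTime a s i :=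
  le_max_right _ _

lemma departureTime_succ_of_lt {n : ℕ} (a s : Fin n → ℝ) (i : Fin n) :
    departureTime a s (i + 1) = max (a i) (departureTime a s i) + s i := by
  simp [departureTime]

lemma departureTime_succ {n : ℕ} (a s : Fin n → ℝ) (i : Fin n) :
    departureTime a s (i + 1) = departureTime a s i + interdeparture a s i := by
  rw [departureTime_succ_of_lt, interdeparture, idleTime, ← add_assoc, ← max_add_add_left]
  simp

lemma departureTime_congr {n : ℕ} (a : Fin n → ℝ) {s t : Fin n → ℝ} {k : ℕ}
    (h : ∀ i : Fin n, (i : ℕ) < k → s i = t i) :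
    departureTime a s k = departureTime a t k := by
  induction k with
  | zero => rfl
  | succ k ih =>
    have ih' := ih fun i hi => h i (hi.trans k.lt_succ_self)
    by_cases hk : k < n
    · simp [departureTime, hk, ih', h ⟨k, hk⟩ k.lt_succ_self]
    · simp [departureTime, hk, ih']

lemma departureTime_init {n : ℕ} (a s : Fin (n + 1) → ℝ) {k : ℕ} (hk : k ≤ n) :
    departureTime a s k = departureTime (Fin.init a) (Fin.init s) k := by
  induction k with
  | zero => rfl
  | succ k ih =>
    have h1 : k < n + 1 := by omega
    have h2 : k < n := by omega
    simp [departureTime, h1, h2, ih h2.le, Fin.init]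

lemma departureTime_eq_sum {n : ℕ} (a s : Fin n → ℝ) {k : ℕ} (hk : k ≤ n) :
    departureTime a s k
      = ∑ j ∈ Finset.univ.filter (fun j : Fin n => (j : ℕ) < k), interdeparture a s j := by
  induction k with
  | zero => simp [departureTime]
  | succ k ih =>
    have hfilter : Finset.univ.filter (fun j : Fin n => (j : ℕ) < k + 1)
        = insert ⟨k, hk⟩ (Finset.univ.filter fun j : Fin n => (j : ℕ) < k) := by
      ext j
      simp only [Finset.mem_filter, Finset.mem_univ, true_and, Finset.mem_insert, Fin.ext_iff]
      omega
    rw [hfilter, Finset.sum_insert (by simp), ← ih (by omega),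
      departureTime_succ a s ⟨k, hk⟩, add_comm]

/-- The departure times that correspond to given interdeparture times. -/
noncomputable def partialSums {n : ℕ} (y : Fin n → ℝ) (i : Fin n) : ℝ :=
  ∑ j ∈ Finset.univ.filter (fun j : Fin n => (j : ℕ) < i + 1), y j

lemma departures_eq_partialSums {n : ℕ} (a s : Fin n → ℝ) :
    departures a s = partialSums (interdeparture a s) :=
  funext fun i => departureTime_eq_sum a s i.2

lemma departureTime_last_eq_sum {n : ℕ} (a s : Fin n → ℝ) :
    departureTime a s n = ∑ j, (idleTime a s j + s j) := by
  rw [departureTime_eq_sum a s le_rfl]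
  simp [interdeparture]

@[fun_prop]
lemma measurable_partialSums {n : ℕ} : Measurable (partialSums (n := n)) := by
  unfold partialSums
  fun_prop

@[fun_prop]
lemma measurable_departureTime {n : ℕ} (a : Fin n → ℝ) (k : ℕ) :
    Measurable fun s => departureTime a s k := by
  induction k with
  | zero => simp only [departureTime]; fun_prop
  | succ k ih =>
    by_cases hk : k < n
    · simp only [departureTime, hk, dite_true]; fun_prop
    · simpa only [departureTime, hk, dite_false] using ih

@[fun_prop]
lemma measurable_idleTime {n : ℕ} (a : Fin n → ℝ) (i : Fin n) :
    Measurable fun s => idleTime a s i := by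
  unfold idleTime
  fun_prop

@[fun_prop]
lemma measurable_interdeparture {n : ℕ} (a : Fin n → ℝ) : Measurable (interdeparture a) := by
  unfold interdeparture
  fun_prop

/-! ### Change of measure for the interdeparture times -/

/-- If `r w` is an inverse likelihood ratio of the law of `w + S` with respect to `η` for each `w`,
then the product of the ratios along the queue plays this role for the law of the interdeparture
times with respect to `η ^ n`. The last packet is peeled off at each step of the induction, as its
idle time is a function of the previous service times. -/
lemma lintegral_mul_prod_le_lintegral_pi {ν η : Measure ℝ} [IsProbabilityMeasure ν]
    [IsProbabilityMeasure η] {r : ℝ → ℝ → ℝ≥0∞} (hr : Measurable (Function.uncurry r))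
    (hle : ∀ w, (ν.map (w + ·)).withDensity (r w) ≤ η) {n : ℕ} (a : Fin n → ℝ)
    {G : (Fin n → ℝ) → ℝ≥0∞} (hG : Measurable G) :
    ∫⁻ s, G (interdeparture a s) * ∏ i, r (idleTime a s i) (interdeparture a s i)
        ∂(Measure.pi fun _ => ν) ≤ ∫⁻ y, G y ∂(Measure.pi fun _ => η) := by
  induction n with
  | zero =>
    have h : ∀ s : Fin 0 → ℝ, interdeparture a s = s := fun s => Subsingleton.elim _ _
    have hpi : Measure.pi (fun _ : Fin 0 => ν) = Measure.pi fun _ => η := by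
      rw [Measure.pi_of_empty, Measure.pi_of_empty]
    simp [h, hpi]
  | succ n ih =>
    have hstep : ∀ (w : ℝ) (h : ℝ → ℝ≥0∞), Measurable h →
        ∫⁻ t, h (w + t) * r w (w + t) ∂ν ≤ ∫⁻ y, h y ∂η := by
      intro w h hh
      have hrw : Measurable (r w) := hr.comp (by fun_prop : Measurable fun y => (w, y))
      calc ∫⁻ t, h (w + t) * r w (w + t) ∂ν
          = ∫⁻ y, (r w * h) y ∂(ν.map (w + ·)) := by
            rw [lintegral_map (hrw.mul hh) (by fun_prop)]
            simp [mul_comm]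
        _ = ∫⁻ y, h y ∂((ν.map (w + ·)).withDensity (r w)) :=
            (lintegral_withDensity_eq_lintegral_mul _ hrw hh).symm
        _ ≤ _ := lintegral_mono' (hle w) le_rfl
    have hpi : ∀ (m : Measure ℝ) [IsProbabilityMeasure m] (H : (Fin (n + 1) → ℝ) → ℝ≥0∞),
        Measurable H → ∫⁻ s, H s ∂(Measure.pi fun _ => m)
          = ∫⁻ s, ∫⁻ t, H (Fin.snoc s t) ∂m ∂(Measure.pi fun _ : Fin n => m) := by
      intro m _ H hH
      have hmp := measurePreserving_piFinSuccAbove (fun _ : Fin (n + 1) => m) (Fin.last n)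
      have hs : ∀ p, (MeasurableEquiv.piFinSuccAbove (fun _ : Fin (n + 1) => ℝ)
          (Fin.last n)).symm p = Fin.snoc (α := fun _ => ℝ) p.2 p.1 := by
        intro p
        simp [MeasurableEquiv.piFinSuccAbove_symm_apply, Fin.insertNthEquiv]
      have hms : Measurable fun p : ℝ × (Fin n → ℝ) => Fin.snoc (α := fun _ => ℝ) p.2 p.1 := by
        simpa only [← hs] using MeasurableEquiv.measurable _
      rw [← (hmp.symm _).lintegral_comp hH]
      simp only [hs]
      exact lintegral_prod_symm' _ (hH.comp hms)
    have hri : ∀ (k : ℕ) (a : Fin k → ℝ) (i : Fin k),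
        Measurable fun s => r (idleTime a s i) (interdeparture a s i) := fun k a i =>
      hr.comp ((measurable_idleTime a i).prodMk
        ((measurable_pi_apply i).comp (measurable_interdeparture a)))
    rw [hpi ν (fun s => G (interdeparture a s) * ∏ i, r (idleTime a s i) (interdeparture a s i))
      ((hG.comp (measurable_interdeparture a)).mul
        (Finset.measurable_fun_prod _ fun i _ => hri _ a i)), hpi η _ hG]
    have hGs : Measurable fun p : (Fin n → ℝ) × ℝ => G (Fin.snoc (α := fun _ => ℝ) p.1 p.2) := by
      refine hG.comp (measurable_pi_lambda _ fun i => ?_)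
      refine Fin.lastCases ?_ (fun j => ?_) i
      · simp only [Fin.snoc_last]; fun_prop
      · simp only [Fin.snoc_castSucc]; fun_prop
    refine le_trans (lintegral_mono fun s => ?_)
      (ih (Fin.init a) (G := fun y => ∫⁻ t, G (Fin.snoc y t) ∂η)
        (Measurable.lintegral_prod_right hGs))
    have hinit : ∀ t : ℝ, Fin.init (Fin.snoc (α := fun _ => ℝ) s t) = s := fun t =>
      Fin.init_snoc _ _
    have hidle : ∀ (t : ℝ) (i : Fin n), idleTime a (Fin.snoc (α := fun _ => ℝ) s t) i.castSucc
        = idleTime (Fin.init a) s i := by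
      intro t i
      have := departureTime_init a (Fin.snoc (α := fun _ => ℝ) s t) (k := i) i.2.le
      rw [hinit] at this
      simp [idleTime, this, Fin.init]
    have hinter : ∀ (t : ℝ) (i : Fin n),
        interdeparture a (Fin.snoc (α := fun _ => ℝ) s t) i.castSucc
          = interdeparture (Fin.init a) s i := by
      intro t i
      simp only [interdeparture, hidle, Fin.snoc_castSucc]
    set w := max (a (Fin.last n) - departureTime (Fin.init a) s n) 0 with hw
    have hlast : ∀ t : ℝ, idleTime a (Fin.snoc (α := fun _ => ℝ) s t) (Fin.last n) = w := by
      intro t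
      have := departureTime_init a (Fin.snoc (α := fun _ => ℝ) s t) (k := n) le_rfl
      rw [hinit] at this
      simp [idleTime, this, hw]
    have hsnoc : ∀ t : ℝ, interdeparture a (Fin.snoc (α := fun _ => ℝ) s t)
        = Fin.snoc (α := fun _ => ℝ) (interdeparture (Fin.init a) s) (w + t) := by
      intro t
      funext i
      refine Fin.lastCases ?_ (fun j => ?_) i
      · simp [interdeparture, hlast]
      · simp [hinter]
    simp only [Fin.prod_univ_castSucc, hidle, hlast, hsnoc, Fin.snoc_castSucc, Fin.snoc_last]
    calc ∫⁻ t, G (Fin.snoc (interdeparture (Fin.init a) s) (w + t)) *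
          ((∏ i, r (idleTime (Fin.init a) s i) (interdeparture (Fin.init a) s i)) * r w (w + t)) ∂ν
        = ∫⁻ t, (G (Fin.snoc (interdeparture (Fin.init a) s) (w + t)) * r w (w + t)) *
          (∏ i, r (idleTime (Fin.init a) s i) (interdeparture (Fin.init a) s i)) ∂ν := by
          congr 1; ext t; ring
      _ = (∫⁻ t, G (Fin.snoc (interdeparture (Fin.init a) s) (w + t)) * r w (w + t) ∂ν) *
          (∏ i, r (idleTime (Fin.init a) s i) (interdeparture (Fin.init a) s i)) :=
          lintegral_mul_const _ (((hGs.comp (by fun_prop :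
            Measurable fun t : ℝ => (interdeparture (Fin.init a) s, w + t)))).mul
            (hr.comp (by fun_prop : Measurable fun t : ℝ => (w, w + t))))
      _ ≤ _ := by
          exact mul_le_mul' (hstep w (fun y => G (Fin.snoc (interdeparture (Fin.init a) s) y))
            (hGs.comp (by fun_prop :
              Measurable fun y : ℝ => (interdeparture (Fin.init a) s, y)))) le_rfl

/-! ### Laws of waiting and departure for one packet -/

/-- The law of `(X - S)⁺`, for independent `X` and `S` of laws `ρ` and `ν`. -/
noncomputable def waitLaw (ν ρ : Measure ℝ) : Measure ℝ :=
  (ρ.prod ν).map fun p => max (p.1 - p.2) 0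

/-- The joint law of `(W, W + S)`, for independent `W` and `S` of laws `σ` and `ν`. -/
noncomputable def inOutLaw (ν σ : Measure ℝ) : Measure (ℝ × ℝ) :=
  (σ.prod ν).map fun p => (p.1, p.1 + p.2)

instance (ν ρ : Measure ℝ) [IsProbabilityMeasure ν] [IsProbabilityMeasure ρ] :
    IsProbabilityMeasure (waitLaw ν ρ) :=
  Measure.isProbabilityMeasure_map (by fun_prop)

instance (ν σ : Measure ℝ) [IsProbabilityMeasure ν] [IsProbabilityMeasure σ] :
    IsProbabilityMeasure (inOutLaw ν σ) :=
  Measure.isProbabilityMeasure_map (by fun_prop)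

/-- The mutual information in nats between the input and the output of the channel `w ↦ w + S`
with input law `σ`. -/
noncomputable def channelInfo (ν σ : Measure ℝ) : ℝ≥0∞ :=
  InformationTheory.klDiv (inOutLaw ν σ) (σ.prod ((inOutLaw ν σ).map Prod.snd))

lemma mutualInfo_fst_add (ν σ : Measure ℝ) [IsProbabilityMeasure ν] [IsProbabilityMeasure σ] :
    mutualInfo (σ.prod ν) (fun ω : ℝ × ℝ => ω.1) (fun ω : ℝ × ℝ => ω.1 + ω.2)
      = channelInfo ν σ / ENNReal.ofReal (Real.log 2) := by
  have h1 : (σ.prod ν).map (fun ω : ℝ × ℝ => ω.1) = σ := by simp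
  rw [mutualInfo, channelInfo, h1, inOutLaw, Measure.map_map (by fun_prop) (by fun_prop)]
  rfl

lemma map_wait_prod (ν ρ : Measure ℝ) [IsProbabilityMeasure ν] [IsProbabilityMeasure ρ] :
    (ρ.prod (ν.prod ν)).map (fun ω : ℝ × ℝ × ℝ => (max (ω.1 - ω.2.1) 0, ω.2.2))
      = (waitLaw ν ρ).prod ν := by
  rw [← (measurePreserving_prodAssoc ρ ν ν).map_eq, Measure.map_map (by fun_prop) (by fun_prop)]
  conv_rhs => rw [← Measure.map_id (μ := ν), waitLaw]
  rw [Measure.map_prod_map _ _ (by fun_prop) (by fun_prop), Measure.map_id]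
  rfl

lemma infoNoFeedback_eq (ν ρ : Measure ℝ) [IsProbabilityMeasure ν] [IsProbabilityMeasure ρ] :
    infoNoFeedback ν ρ = channelInfo ν (waitLaw ν ρ) / ENNReal.ofReal (Real.log 2) := by
  rw [← mutualInfo_fst_add, ← map_wait_prod]
  unfold infoNoFeedback mutualInfo
  rw [Measure.map_map (by fun_prop) (by fun_prop), Measure.map_map (by fun_prop) (by fun_prop),
    Measure.map_map (by fun_prop) (by fun_prop)]
  rfl

lemma meanWait_eq (ν ρ : Measure ℝ) :
    meanWait ν ρ = ∫⁻ w, ENNReal.ofReal w ∂(waitLaw ν ρ) := by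
  rw [meanWait, waitLaw, lintegral_map (by fun_prop) (by fun_prop)]

/-! ### The inverse likelihood ratio of the channel -/

open ProbabilityTheory InformationTheory in
/-- If the relative entropy of the joint law of input and output with respect to `σ.prod η` is
finite, then there is an inverse likelihood ratio `r w` with respect to `η` for every input `w`,
and the mean of `-log r` is this relative entropy. The ratio is set to `0` on the null set of the
inputs for which the law of the output is not absolutely continuous. -/
lemma exists_inverse_likelihoodRatio {ν σ η : Measure ℝ} [IsProbabilityMeasure ν]
    [IsProbabilityMeasure σ] [IsProbabilityMeasure η]
    (h : klDiv (inOutLaw ν σ) (σ.prod η) ≠ ∞) :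
    ∃ r : ℝ → ℝ → ℝ≥0∞, Measurable (Function.uncurry r) ∧
      (∀ w, (ν.map (w + ·)).withDensity (r w) ≤ η) ∧
      (∀ᵐ p ∂(inOutLaw ν σ), r p.1 p.2 ≠ 0 ∧ r p.1 p.2 ≠ ∞) ∧
      Integrable (fun p => -Real.log (r p.1 p.2).toReal) (inOutLaw ν σ) ∧
      ∫ p, -Real.log (r p.1 p.2).toReal ∂(inOutLaw ν σ)
        = (klDiv (inOutLaw ν σ) (σ.prod η)).toReal := by
  obtain ⟨hac, hint⟩ := klDiv_ne_top_iff.1 h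
  let κ : Kernel ℝ ℝ :=
    (Kernel.deterministic id measurable_id ×ₖ Kernel.const ℝ ν).map fun p => p.1 + p.2
  have hadd : Measurable fun p : ℝ × ℝ => p.1 + p.2 := by fun_prop
  have hκ : ∀ w, κ w = ν.map (w + ·) := by
    intro w
    rw [Kernel.map_apply _ hadd, Kernel.prod_apply, Kernel.deterministic_apply,
      Kernel.const_apply, id, Measure.dirac_prod, Measure.map_map hadd (by fun_prop)]
    rfl
  have : IsMarkovKernel κ := Kernel.IsMarkovKernel.map _ hadd
  have hJ : inOutLaw ν σ = σ ⊗ₘ κ := by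
    ext s hs
    rw [Measure.compProd_apply hs, inOutLaw, Measure.map_apply (by fun_prop) hs,
      Measure.prod_apply (hs.preimage (by fun_prop))]
    refine lintegral_congr fun w => ?_
    rw [hκ, Measure.map_apply (by fun_prop) (hs.preimage (by fun_prop))]
    rfl
  have hprod : σ.prod η = σ ⊗ₘ Kernel.const ℝ η := (Measure.compProd_const).symm
  set f := κ.rnDeriv (Kernel.const ℝ η) with hf
  have hfm : Measurable (Function.uncurry f) := Kernel.measurable_rnDeriv _ _
  have hgood : ∀ᵐ w ∂σ, κ w ≪ η := by
    rw [hJ, hprod] at hac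
    exact hac.kernel_of_compProd
  have hgoodm : MeasurableSet {w | κ w ≪ η} :=
    Kernel.measurableSet_absolutelyContinuous κ (Kernel.const ℝ η)
  have hdens : ∀ w, κ w ≪ η → κ w = η.withDensity (f w) := by
    intro w hw
    rw [← Kernel.withDensity_rnDeriv_eq (κ := κ) (η := Kernel.const ℝ η) hw,
      Kernel.withDensity_apply _ hfm, Kernel.const_apply]
  have hJdens : inOutLaw ν σ = (σ.prod η).withDensity fun p => f p.1 p.2 := by
    rw [hJ, hprod, ← Measure.compProd_withDensity hfm]
    refine Measure.compProd_congr ?_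
    filter_upwards [hgood] with w hw using
      (Kernel.withDensity_rnDeriv_eq (κ := κ) (η := Kernel.const ℝ η) hw).symm
  have hrn : (inOutLaw ν σ).rnDeriv (σ.prod η) =ᵐ[inOutLaw ν σ] fun p => f p.1 p.2 := by
    refine hac.ae_eq ?_
    conv_lhs => rw [hJdens]
    exact Measure.rnDeriv_withDensity _ hfm
  have hgoodJ : ∀ᵐ p ∂(inOutLaw ν σ), κ p.1 ≪ η := by
    have hfst : (inOutLaw ν σ).map Prod.fst = σ := by
      rw [hJ]
      exact Measure.fst_compProd _ _
    rw [← hfst] at hgood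
    exact ae_of_ae_map (by fun_prop) hgood
  classical
  let r : ℝ → ℝ → ℝ≥0∞ := fun w y => if κ w ≪ η then (f w y)⁻¹ else 0
  have hr : ∀ᵐ p ∂(inOutLaw ν σ), r p.1 p.2 = (f p.1 p.2)⁻¹ := by
    filter_upwards [hgoodJ] with p hp
    simp only [r, if_pos hp]
  have hllr : (fun p => -Real.log (r p.1 p.2).toReal) =ᵐ[inOutLaw ν σ]
      llr (inOutLaw ν σ) (σ.prod η) := by
    filter_upwards [hr, hrn] with p hp hp'
    rw [llr, hp, hp', ENNReal.toReal_inv, Real.log_inv, neg_neg]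
  refine ⟨r, ?_, ?_, ?_, hint.congr hllr.symm, ?_⟩
  · exact Measurable.ite (hgoodm.preimage measurable_fst) hfm.inv measurable_const
  · intro w
    by_cases hw : κ w ≪ η
    · have hfw : Measurable (f w) := hfm.comp (by fun_prop : Measurable fun y => (w, y))
      have hrw : r w = (f w)⁻¹ := by
        funext y
        simp only [r, if_pos hw, Pi.inv_apply]
      rw [← hκ, hdens w hw, hrw, ← withDensity_mul _ hfw hfw.inv]
      calc η.withDensity (f w * (f w)⁻¹) ≤ η.withDensity 1 :=
            withDensity_mono (ae_of_all _ fun y => ENNReal.mul_inv_le_one _)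
        _ = η := withDensity_one
    · have hrw : r w = 0 := by
        funext y
        simp only [r, if_neg hw, Pi.zero_apply]
      rw [hrw, withDensity_zero]
      exact Measure.zero_le _
  · filter_upwards [hr, hrn, Measure.rnDeriv_pos hac,
      hac.ae_le (Measure.rnDeriv_lt_top (inOutLaw ν σ) (σ.prod η))] with p hp hp' hpos hlt
    rw [hp, ← hp']
    exact ⟨ENNReal.inv_ne_zero.2 hlt.ne, ENNReal.inv_ne_top.2 hpos.ne'⟩
  · rw [integral_congr_ae hllr, toReal_klDiv_of_measure_eq hac (by simp)]

/-! ### Coordinates of a product measure -/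

/-- A function of the other coordinates is independent of coordinate `i`. -/
lemma map_prodMk_eval_pi {ι α : Type*} [Fintype ι] [DecidableEq ι] [MeasurableSpace α]
    {ν : Measure ℝ} [IsProbabilityMeasure ν] {f : (ι → ℝ) → α} (hf : Measurable f) (i : ι)
    (hi : ∀ s t, (∀ j, j ≠ i → s j = t j) → f s = f t) :
    (Measure.pi fun _ : ι => ν).map (fun s => (f s, s i))
      = ((Measure.pi fun _ : ι => ν).map f).prod ν := by
  have hind := (ProbabilityTheory.iIndepFun_pi (μ := fun _ : ι => ν) (X := fun _ => id)
    fun _ => aemeasurable_id).indepFun_finset (Finset.univ.erase i) {i} (by simp)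
    fun j => measurable_pi_apply j
  -- The coordinate `i` is replaced by `0` to view `f` as a function of the other ones.
  let g : ({j // j ∈ Finset.univ.erase i} → ℝ) → ι → ℝ :=
    fun s j => if h : j ∈ Finset.univ.erase i then s ⟨j, h⟩ else 0
  have hg : Measurable g := by
    refine measurable_pi_lambda _ fun j => ?_
    by_cases h : j ∈ Finset.univ.erase i
    · simp only [g, h, dite_true]; fun_prop
    · simp only [g, h, dite_false]; fun_prop
  have hfg : ∀ s : ι → ℝ, f (g fun j => s j) = f s := by
    intro s
    refine hi _ _ fun j hj => ?_
    simp [g, hj]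
  have hind' := hind.comp (hf.comp hg)
    (measurable_pi_apply (⟨i, by simp⟩ : ({i} : Finset ι)))
  rw [ProbabilityTheory.indepFun_iff_map_prod_eq_prod_map_map
    (((hf.comp hg).comp (by fun_prop)).aemeasurable)
    (((measurable_pi_apply _).comp (by fun_prop)).aemeasurable)] at hind'
  have hev : (Measure.pi fun _ : ι => ν).map (fun s => s i) = ν :=
    (measurePreserving_eval (fun _ : ι => ν) i).map_eq
  have h1 : ((f ∘ g) ∘ fun (s : ι → ℝ) (j : {j // j ∈ Finset.univ.erase i}) => id (s j)) = f :=
    funext hfg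
  rw [h1] at hind'
  exact hind'.trans (congrArg _ hev)

/-! ### The information bound for one message -/

/-- The inequality `x ≤ exp x - 1`, applied to `x = log M * 1_E - ∑ log (likelihood ratio)` and
integrated: the probability of `E` is bounded through the mean log-likelihood ratios along the queue
and through its probability under the reference law `η ^ n`. -/
lemma log_mul_measureReal_le {ν η : Measure ℝ} [IsProbabilityMeasure ν]
    [IsProbabilityMeasure η] {r : ℝ → ℝ → ℝ≥0∞} (hr : Measurable (Function.uncurry r))
    (hle : ∀ w, (ν.map (w + ·)).withDensity (r w) ≤ η) {n : ℕ} (a : Fin n → ℝ)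
    (hpos : ∀ i, ∀ᵐ s ∂(Measure.pi fun _ : Fin n => ν),
      r (idleTime a s i) (interdeparture a s i) ≠ 0 ∧
        r (idleTime a s i) (interdeparture a s i) ≠ ∞)
    (hint : ∀ i, Integrable (fun s => -Real.log (r (idleTime a s i) (interdeparture a s i)).toReal)
      (Measure.pi fun _ : Fin n => ν))
    {E : Set (Fin n → ℝ)} (hE : MeasurableSet E) {M : ℝ} (hM : 1 ≤ M) :
    Real.log M * (Measure.pi fun _ : Fin n => ν).real {s | interdeparture a s ∈ E}
      ≤ ∑ i, ∫ s, -Real.log (r (idleTime a s i) (interdeparture a s i)).toReal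
          ∂(Measure.pi fun _ : Fin n => ν)
        + (M - 1) * (Measure.pi fun _ : Fin n => η).real E := by
  classical
  set P := Measure.pi fun _ : Fin n => ν
  set Q := Measure.pi fun _ : Fin n => η
  have hE' : MeasurableSet {s | interdeparture a s ∈ E} := measurable_interdeparture a hE
  let φ : (Fin n → ℝ) → ℝ := fun s =>
    {s | interdeparture a s ∈ E}.indicator (fun _ => Real.log M) s
      - ∑ i, -Real.log (r (idleTime a s i) (interdeparture a s i)).toReal
  have hind : Integrable ({s | interdeparture a s ∈ E}.indicator fun _ => Real.log M) P :=
    (integrable_const _).indicator hE'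
  have hφ : Integrable φ P := hind.sub (integrable_finsetSum _ fun i _ => hint i)
  have hφint : ∫ s, φ s ∂P = Real.log M * P.real {s | interdeparture a s ∈ E}
      - ∑ i, ∫ s, -Real.log (r (idleTime a s i) (interdeparture a s i)).toReal ∂P := by
    rw [integral_sub hind (integrable_finsetSum _ fun i _ => hint i),
      integral_finsetSum _ fun i _ => hint i, integral_indicator_const _ hE']
    simp [mul_comm]
  let G : (Fin n → ℝ) → ℝ≥0∞ := fun y => 1 + E.indicator (fun _ => ENNReal.ofReal (M - 1)) y
  have hG : Measurable G := (measurable_const.indicator hE).const_add 1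
  have hGint : ∫⁻ y, G y ∂Q = 1 + ENNReal.ofReal (M - 1) * Q E := by
    rw [lintegral_add_left measurable_const, lintegral_indicator_const hE]
    simp
  have hexp : ∀ᵐ s ∂P, ENNReal.ofReal (Real.exp (φ s))
      = G (interdeparture a s) * ∏ i, r (idleTime a s i) (interdeparture a s i) := by
    filter_upwards [ae_all_iff.2 hpos] with s hs
    have h1 : ∀ i, ENNReal.ofReal
        (Real.exp (Real.log (r (idleTime a s i) (interdeparture a s i)).toReal))
        = r (idleTime a s i) (interdeparture a s i) := fun i => by
      rw [Real.exp_log (ENNReal.toReal_pos (hs i).1 (hs i).2), ENNReal.ofReal_toReal (hs i).2]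
    have h2 : ENNReal.ofReal
        (Real.exp ({s | interdeparture a s ∈ E}.indicator (fun _ => Real.log M) s))
        = G (interdeparture a s) := by
      by_cases h : interdeparture a s ∈ E
      · simp only [G, Set.indicator, Set.mem_ofPred_eq, h, if_true]
        rw [Real.exp_log (by linarith), ← ENNReal.ofReal_one, ← ENNReal.ofReal_add zero_le_one
          (by linarith)]
        simp
      · simp [G, Set.indicator, h]
    simp only [φ, sub_eq_add_neg, ← Finset.sum_neg_distrib, neg_neg, Real.exp_add, Real.exp_sum]
    rw [ENNReal.ofReal_mul (Real.exp_pos _).le, h2,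
      ENNReal.ofReal_prod_of_nonneg fun i _ => (Real.exp_pos _).le]
    simp only [h1]
  have hlint : ∫⁻ s, ENNReal.ofReal (Real.exp (φ s)) ∂P ≤ 1 + ENNReal.ofReal (M - 1) * Q E := by
    rw [lintegral_congr_ae hexp, ← hGint]
    exact lintegral_mul_prod_le_lintegral_pi hr hle a hG
  have hfin : 1 + ENNReal.ofReal (M - 1) * Q E ≠ ∞ :=
    ENNReal.add_ne_top.2 ⟨ENNReal.one_ne_top, ENNReal.mul_ne_top ENNReal.ofReal_ne_top
      (measure_ne_top _ _)⟩
  have hexpm : AEStronglyMeasurable (fun s => Real.exp (φ s)) P :=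
    Real.continuous_exp.comp_aestronglyMeasurable hφ.aestronglyMeasurable
  have hexpint : Integrable (fun s => Real.exp (φ s)) P :=
    (lintegral_ofReal_ne_top_iff_integrable hexpm (ae_of_all _ fun s => (Real.exp_pos _).le)).1
      (ne_top_of_le_ne_top hfin hlint)
  have hexple : ∫ s, Real.exp (φ s) ∂P ≤ 1 + (M - 1) * Q.real E := by
    rw [integral_eq_lintegral_of_nonneg_ae (ae_of_all _ fun s => (Real.exp_pos _).le) hexpm]
    refine (ENNReal.toReal_mono hfin hlint).trans_eq ?_
    rw [ENNReal.toReal_add ENNReal.one_ne_top (ENNReal.mul_ne_top ENNReal.ofReal_ne_top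
      (measure_ne_top _ _)), ENNReal.toReal_mul, ENNReal.toReal_ofReal (by linarith)]
    simp [measureReal_def]
  have hmain : ∫ s, φ s ∂P ≤ ∫ s, (Real.exp (φ s) - 1) ∂P :=
    integral_mono hφ (hexpint.sub (integrable_const _)) fun s => by
      have := Real.add_one_le_exp (φ s)
      linarith
  rw [integral_sub hexpint (integrable_const _), hφint] at hmain
  simp only [integral_const, probReal_univ, smul_eq_mul, mul_one] at hmain
  linarith

/-! ### Laws of the idle times -/

lemma map_idleTime_interdeparture {ν : Measure ℝ} [IsProbabilityMeasure ν] {n : ℕ}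
    (a : Fin n → ℝ) (i : Fin n) :
    (Measure.pi fun _ : Fin n => ν).map (fun s => (idleTime a s i, interdeparture a s i))
      = inOutLaw ν ((Measure.pi fun _ : Fin n => ν).map fun s => idleTime a s i) := by
  rw [inOutLaw, ← map_prodMk_eval_pi (measurable_idleTime a i) i, Measure.map_map (by fun_prop)
    (by fun_prop)]
  · rfl
  · intro s t h
    rw [idleTime, idleTime, departureTime_congr a fun j hj => h j (Fin.ne_of_lt hj)]

lemma TimeModel.zero_mem_times (model : TimeModel) : 0 ∈ model.times := by
  cases model
  · exact ⟨0, by simp⟩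
  · trivial

lemma TimeModel.natCast_mem_times (model : TimeModel) (m : ℕ) : (m : ℝ) ∈ model.times := by
  cases model
  · exact ⟨m, by simp⟩
  · trivial

lemma TimeModel.add_mem_times {model : TimeModel} {x y : ℝ} (hx : x ∈ model.times)
    (hy : y ∈ model.times) : x + y ∈ model.times := by
  cases model
  · obtain ⟨k, rfl⟩ := hx
    obtain ⟨l, rfl⟩ := hy
    exact ⟨k + l, by simp⟩
  · trivial

lemma TimeModel.sub_mem_times {model : TimeModel} {x y : ℝ} (hx : x ∈ model.times)
    (hy : y ∈ model.times) : x - y ∈ model.times := by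
  cases model
  · obtain ⟨k, rfl⟩ := hx
    obtain ⟨l, rfl⟩ := hy
    exact ⟨k - l, by simp⟩
  · trivial

lemma TimeModel.max_mem_times {model : TimeModel} {x y : ℝ} (hx : x ∈ model.times)
    (hy : y ∈ model.times) : max x y ∈ model.times := by
  rcases max_choice x y with h | h <;> rwa [h]

lemma TimeModel.measurableSet_times (model : TimeModel) : MeasurableSet model.times := by
  cases model
  · exact (Set.countable_range _).measurableSet
  · exact MeasurableSet.univ

lemma departureTime_mem_times {model : TimeModel} {n : ℕ} {a s : Fin n → ℝ}
    (ha : ∀ i, a i ∈ model.times) (hs : ∀ i, s i ∈ model.times) (k : ℕ) :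
    departureTime a s k ∈ model.times := by
  induction k with
  | zero => exact model.zero_mem_times
  | succ k ih =>
    rw [departureTime]
    split_ifs with hk
    · exact TimeModel.add_mem_times (TimeModel.max_mem_times (ha _) ih) (hs _)
    · exact ih

lemma waitLaw_dirac_zero {ν : Measure ℝ} [IsProbabilityMeasure ν] (hν : ∀ᵐ s ∂ν, 0 ≤ s) :
    waitLaw ν (Measure.dirac 0) = Measure.dirac 0 := by
  rw [waitLaw, Measure.dirac_prod, Measure.map_map (by fun_prop) (by fun_prop)]
  have h : ((fun p : ℝ × ℝ => max (p.1 - p.2) 0) ∘ Prod.mk 0) =ᵐ[ν] fun _ => (0 : ℝ) := by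
    filter_upwards [hν] with s hs
    simp [hs]
  rw [Measure.map_congr h]
  simp

/-- If the first packet arrives at time `0`, every idle time is of the form `(X - S)⁺`, with `X`
time-valued and independent of the service time `S`: that of the preceding packet, where `X` is
the difference between the arrival time and the time at which that packet enters service. -/
lemma exists_waitLaw_eq_map_idleTime {model : TimeModel} {ν : Measure ℝ} [IsProbabilityMeasure ν]
    (hnonneg : ∀ᵐ s ∂ν, 0 ≤ s) (hmem : ∀ᵐ s ∂ν, s ∈ model.times) {n : ℕ} (a : Fin n → ℝ)
    (ha : ∀ i, a i ∈ model.times) (hzero : ∀ i : Fin n, (i : ℕ) = 0 → a i = 0) (i : Fin n) :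
    ∃ ρ : Measure ℝ, IsProbabilityMeasure ρ ∧ (∀ᵐ x ∂ρ, x ∈ model.times) ∧
      (Measure.pi fun _ : Fin n => ν).map (fun s => idleTime a s i) = waitLaw ν ρ := by
  obtain ⟨k, hk⟩ := i
  cases k with
  | zero =>
    refine ⟨Measure.dirac 0, inferInstance, ?_, ?_⟩
    · exact (ae_dirac_iff model.measurableSet_times).2 model.zero_mem_times
    · rw [waitLaw_dirac_zero hnonneg]
      simp [idleTime, departureTime, hzero]
  | succ k =>
    have hk' : k < n := by omega
    let X : (Fin n → ℝ) → ℝ := fun s => a ⟨k + 1, hk⟩ - max (a ⟨k, hk'⟩) (departureTime a s k)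
    have hX : Measurable X := by fun_prop
    refine ⟨(Measure.pi fun _ : Fin n => ν).map X, Measure.isProbabilityMeasure_map
      hX.aemeasurable, ?_, ?_⟩
    · refine (ae_map_iff (p := fun x => x ∈ model.times) hX.aemeasurable
        model.measurableSet_times).2 ?_
      have hall : ∀ᵐ s ∂(Measure.pi fun _ : Fin n => ν), ∀ i, s i ∈ model.times :=
        ae_all_iff.2 fun i => (measurePreserving_eval (fun _ : Fin n => ν)
          i).quasiMeasurePreserving.ae hmem
      filter_upwards [hall] with s hs
      exact TimeModel.sub_mem_times (ha _) (TimeModel.max_mem_times (ha _)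
        (departureTime_mem_times ha hs k))
    · rw [waitLaw, ← map_prodMk_eval_pi hX ⟨k, hk'⟩, Measure.map_map (by fun_prop) (by fun_prop)]
      · congr 1
        funext s
        have := departureTime_succ_of_lt a s ⟨k, hk'⟩
        simp only at this
        simp only [idleTime, this, Function.comp, X, sub_sub]
      · intro s t h
        simp only [X]
        rw [departureTime_congr a fun j hj => h j fun hjk => by simp [hjk] at hj]

/-! ### Mixtures of laws -/

lemma map_prod_sum_smul {ν : Measure ℝ} [IsProbabilityMeasure ν] {α ι : Type*} [MeasurableSpace α]
    {f : ℝ × ℝ → α} (hf : Measurable f) (t : Finset ι) (p : ι → ℝ≥0∞) (ρ : ι → Measure ℝ)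
    [∀ j, IsProbabilityMeasure (ρ j)] :
    ((∑ j ∈ t, p j • ρ j).prod ν).map f = ∑ j ∈ t, p j • ((ρ j).prod ν).map f := by
  classical
  induction t using Finset.induction_on with
  | empty => simp
  | insert j t hj ih =>
    have : SFinite (∑ j ∈ t, p j • ρ j) := by
      rw [← Measure.sum_coe_finset]
      infer_instance
    rw [Finset.sum_insert hj, Finset.sum_insert hj, ← ih, Measure.add_prod,
      Measure.map_add _ _ hf, Measure.prod_smul_left, Measure.map_smul]

lemma waitLaw_sum_smul (ν : Measure ℝ) [IsProbabilityMeasure ν] {ι : Type*} (t : Finset ι)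
    (p : ι → ℝ≥0∞) (ρ : ι → Measure ℝ) [∀ j, IsProbabilityMeasure (ρ j)] :
    waitLaw ν (∑ j ∈ t, p j • ρ j) = ∑ j ∈ t, p j • waitLaw ν (ρ j) :=
  map_prod_sum_smul (by fun_prop) t p ρ

lemma inOutLaw_sum_smul (ν : Measure ℝ) [IsProbabilityMeasure ν] {ι : Type*} (t : Finset ι)
    (p : ι → ℝ≥0∞) (σ : ι → Measure ℝ) [∀ j, IsProbabilityMeasure (σ j)] :
    inOutLaw ν (∑ j ∈ t, p j • σ j) = ∑ j ∈ t, p j • inOutLaw ν (σ j) :=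
  map_prod_sum_smul (by fun_prop) t p σ

lemma isProbabilityMeasure_sum_smul {ι : Type*} [Fintype ι] {p : ι → ℝ≥0∞} (hp : ∑ j, p j = 1)
    (ρ : ι → Measure ℝ) [∀ j, IsProbabilityMeasure (ρ j)] :
    IsProbabilityMeasure (∑ j, p j • ρ j) :=
  ⟨by simp [Measure.finsetSum_apply, hp]⟩

/-- Several input laws `σ j` are compared with their mixture: one inverse likelihood ratio `r`,
that of the mixture, serves all of them, and the mean log-likelihood ratios average to the
information of the mixture. -/
lemma exists_inverse_likelihoodRatio_mixture {ν : Measure ℝ} [IsProbabilityMeasure ν] {ι : Type*}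
    [Fintype ι] {p : ι → ℝ≥0∞} (hp : ∑ j, p j = 1) (hp0 : ∀ j, p j ≠ 0)
    (σ : ι → Measure ℝ) [∀ j, IsProbabilityMeasure (σ j)]
    (h : channelInfo ν (∑ j, p j • σ j) ≠ ∞) :
    ∃ (r : ℝ → ℝ → ℝ≥0∞) (η : Measure ℝ), IsProbabilityMeasure η ∧
      Measurable (Function.uncurry r) ∧
      (∀ w, (ν.map (w + ·)).withDensity (r w) ≤ η) ∧
      (∀ j, ∀ᵐ x ∂(inOutLaw ν (σ j)), r x.1 x.2 ≠ 0 ∧ r x.1 x.2 ≠ ∞) ∧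
      (∀ j, Integrable (fun x => -Real.log (r x.1 x.2).toReal) (inOutLaw ν (σ j))) ∧
      ∑ j, (p j).toReal * ∫ x, -Real.log (r x.1 x.2).toReal ∂(inOutLaw ν (σ j))
        = (channelInfo ν (∑ j, p j • σ j)).toReal := by
  have hprob := isProbabilityMeasure_sum_smul hp σ
  have hη : IsProbabilityMeasure ((inOutLaw ν (∑ j, p j • σ j)).map Prod.snd) :=
    Measure.isProbabilityMeasure_map (by fun_prop)
  have hptop : ∀ j, p j ≠ ∞ := fun j =>
    ne_top_of_le_ne_top ENNReal.one_ne_top (hp ▸ Finset.single_le_sum_of_canonicallyOrdered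
      (Finset.mem_univ j))
  obtain ⟨r, hr, hle, hpos, hint, hval⟩ := exists_inverse_likelihoodRatio h
  have hsum := inOutLaw_sum_smul ν Finset.univ p σ
  have hint' := hint
  rw [hsum, integrable_finsetSum_measure] at hint'
  refine ⟨r, _, hη, hr, hle, fun j => ?_, fun j => ?_, ?_⟩
  · have hac : inOutLaw ν (σ j) ≪ inOutLaw ν (∑ j, p j • σ j) := by
      refine Measure.AbsolutelyContinuous.mk fun s hs h0 => ?_
      rw [hsum, Measure.finsetSum_apply, Finset.sum_eq_zero_iff] at h0
      have := h0 j (Finset.mem_univ j)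
      simpa [hp0 j] using this
    exact hac.ae_le hpos
  · exact (integrable_smul_measure (hp0 j) (hptop j)).1 (hint' j (Finset.mem_univ j))
  · rw [channelInfo, ← hval, hsum, integral_finsetSum_measure hint']
    simp only [integral_smul_measure, smul_eq_mul]

/-! ### The information bound for a code -/

lemma infoNoFeedback_le_supInfoNoFeedback {model : TimeModel} {ν ρ : Measure ℝ} {a : ℝ}
    [hρ : IsProbabilityMeasure ρ] (hmem : ∀ᵐ x ∂ρ, x ∈ model.times)
    (hmean : meanWait ν ρ ≤ ENNReal.ofReal a) :
    infoNoFeedback ν ρ ≤ supInfoNoFeedback model ν a :=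
  le_iSup_of_le ρ <| le_iSup_of_le hρ <| le_iSup_of_le hmem <| le_iSup_of_le hmean le_rfl

/-- Fano's inequality combined with the single-letter bound, for a code whose first packet always
arrives at time `0`. The mean idle time per packet may be any `b` above the constraint `a`:
mixing with a law of idle time `0` restores the constraint, at the price of a factor `b / a`. -/
lemma log_mul_sum_le {model : TimeModel} {ν : Measure ℝ} [IsProbabilityMeasure ν]
    (hnonneg : ∀ᵐ s ∂ν, 0 ≤ s) (hmem : ∀ᵐ s ∂ν, s ∈ model.times) {n M : ℕ} (hn : 0 < n)
    (hM : 0 < M) (c : TimingCode model n M)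
    (hzero : ∀ u (i : Fin n), (i : ℕ) = 0 → c.arrival u i = 0) {a b : ℝ} (ha : 0 < a)
    (hab : a < b)
    (hmean : ∑ u, ∑ i, ∫⁻ s, ENNReal.ofReal (idleTime (c.arrival u) s i)
      ∂(Measure.pi fun _ : Fin n => ν) ≤ ENNReal.ofReal (M * n * b))
    (htop : supInfoNoFeedback model ν a ≠ ∞) :
    Real.log M * ∑ u, (Measure.pi fun _ : Fin n => ν).real
        {s | c.decoder (departures (c.arrival u) s) = u}
      ≤ M * n * (b / a) * ((supInfoNoFeedback model ν a).toReal * Real.log 2) + M := by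
  have hn' : (0 : ℝ) < n := by exact_mod_cast hn
  have hM' : (0 : ℝ) < M := by exact_mod_cast hM
  have hM1 : (1 : ℝ) ≤ M := by exact_mod_cast hM
  have hb : 0 < b := ha.trans hab
  have hlog2 : 0 < Real.log 2 := Real.log_pos one_lt_two
  choose ρ hρ hρmem hρlaw using fun u i => exists_waitLaw_eq_map_idleTime hnonneg hmem
    (c.arrival u) (c.arrival_mem_times u) (hzero u) i
  -- The index `none` stands for a packet without idle time: `(0 - S)⁺ = 0`.
  let ρ' : Option (Fin M × Fin n) → Measure ℝ := fun j =>
    j.elim (Measure.dirac 0) fun j => ρ j.1 j.2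
  have hρ' : ∀ j, IsProbabilityMeasure (ρ' j) := by
    rintro (_ | j)
    · exact inferInstanceAs (IsProbabilityMeasure (Measure.dirac (0 : ℝ)))
    · exact hρ _ _
  let p : Option (Fin M × Fin n) → ℝ≥0∞ := fun j =>
    j.elim (ENNReal.ofReal (1 - a / b)) fun _ => ENNReal.ofReal (a / (M * n * b))
  have hp0 : ∀ j, p j ≠ 0 := by
    rintro (_ | j)
    · simpa [p] using (div_lt_one hb).2 hab
    · simp only [p, Option.elim, ne_eq, ENNReal.ofReal_eq_zero, not_le]
      positivity
  have hp : ∑ j, p j = 1 := by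
    simp only [Fintype.sum_option, p, Option.elim, Finset.sum_const, Finset.card_univ,
      Fintype.card_prod, Fintype.card_fin, nsmul_eq_mul]
    rw [← ENNReal.ofReal_natCast, ← ENNReal.ofReal_mul (by positivity),
      ← ENNReal.ofReal_add (by simpa using ((div_lt_one hb).2 hab).le) (by positivity),
      ← ENNReal.ofReal_one]
    congr 1
    push_cast
    field_simp
    ring
  set ρbar := ∑ j, p j • ρ' j with hρbar
  have hρbarp : IsProbabilityMeasure ρbar := isProbabilityMeasure_sum_smul hp ρ'
  have hwait : waitLaw ν ρbar = ∑ j, p j • waitLaw ν (ρ' j) := waitLaw_sum_smul ν _ p ρ'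
  have hρbarmem : ∀ᵐ x ∂ρbar, x ∈ model.times := by
    rw [ae_iff, hρbar, Measure.finsetSum_apply, Finset.sum_eq_zero_iff]
    rintro (_ | j) -
    · have : ∀ᵐ x ∂(Measure.dirac (0 : ℝ)), x ∈ model.times :=
        (ae_dirac_iff model.measurableSet_times).2 model.zero_mem_times
      rw [Measure.smul_apply, smul_eq_mul]
      exact mul_eq_zero_of_right _ (ae_iff.1 this)
    · rw [Measure.smul_apply, smul_eq_mul]
      exact mul_eq_zero_of_right _ (ae_iff.1 (hρmem j.1 j.2))
  have hρbarmean : meanWait ν ρbar ≤ ENNReal.ofReal a := by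
    rw [meanWait_eq, hwait, lintegral_finsetSum_measure]
    simp only [lintegral_smul_measure, Fintype.sum_option, ρ', Option.elim, smul_eq_mul,
      waitLaw_dirac_zero hnonneg, p, ← hρlaw]
    rw [lintegral_dirac' _ (by fun_prop), Fintype.sum_prod_type]
    simp only [ENNReal.ofReal_zero, mul_zero, zero_add, ← Finset.mul_sum]
    calc _ = ENNReal.ofReal (a / (M * n * b)) * ∑ u, ∑ i,
          ∫⁻ s, ENNReal.ofReal (idleTime (c.arrival u) s i) ∂(Measure.pi fun _ : Fin n => ν) := by
          congr! 5 with u _ i _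
          rw [lintegral_map (by fun_prop) (by fun_prop)]
      _ ≤ ENNReal.ofReal (a / (M * n * b)) * ENNReal.ofReal (M * n * b) := by gcongr
      _ = ENNReal.ofReal a := by
          rw [← ENNReal.ofReal_mul (by positivity), div_mul_cancel₀ _ (by positivity)]
  have hinfo : channelInfo ν (waitLaw ν ρbar)
      ≤ supInfoNoFeedback model ν a * ENNReal.ofReal (Real.log 2) := by
    have := infoNoFeedback_le_supInfoNoFeedback hρbarmem hρbarmean
    rwa [infoNoFeedback_eq, ENNReal.div_le_iff (by simpa using hlog2)
      ENNReal.ofReal_ne_top] at this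
  have hinfotop := ne_top_of_le_ne_top (ENNReal.mul_ne_top htop ENNReal.ofReal_ne_top) hinfo
  rw [hwait] at hinfo hinfotop
  obtain ⟨r, η, hη, hr, hle, hpos, hint, hval⟩ :=
    exists_inverse_likelihoodRatio_mixture hp hp0 (fun j => waitLaw ν (ρ' j)) hinfotop
  have hlogm : Measurable fun x : ℝ × ℝ => -Real.log (r x.1 x.2).toReal :=
    (Real.measurable_log.comp hr.ennreal_toReal).neg
  have hlaw : ∀ u i, inOutLaw ν (waitLaw ν (ρ' (some (u, i))))
      = (Measure.pi fun _ : Fin n => ν).map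
        fun s => (idleTime (c.arrival u) s i, interdeparture (c.arrival u) s i) := by
    intro u i
    rw [map_idleTime_interdeparture, hρlaw]
    rfl
  have hpair : ∀ {k : ℕ} (a : Fin k → ℝ) (i : Fin k),
      Measurable fun s => (idleTime a s i, interdeparture a s i) := fun a i =>
    (measurable_idleTime a i).prodMk ((measurable_pi_apply i).comp (measurable_interdeparture a))
  have hE : ∀ u, MeasurableSet {y | c.decoder (partialSums y) = u} := fun u =>
    (c.measurable_decoder.comp measurable_partialSums) (measurableSet_singleton u)
  have hmessage : ∀ u, Real.log M * (Measure.pi fun _ : Fin n => ν).real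
        {s | c.decoder (departures (c.arrival u) s) = u}
      ≤ ∑ i, ∫ x, -Real.log (r x.1 x.2).toReal ∂(inOutLaw ν (waitLaw ν (ρ' (some (u, i)))))
        + (M - 1) * (Measure.pi fun _ : Fin n => η).real {y | c.decoder (partialSums y) = u} := by
    intro u
    have hpos' := fun i => hpos (some (u, i))
    have hint' := fun i => hint (some (u, i))
    simp only [hlaw] at hpos' hint' ⊢
    simp only [departures_eq_partialSums, integral_map (hpair _ _).aemeasurable
      hlogm.aestronglyMeasurable]
    exact log_mul_measureReal_le hr hle (c.arrival u)
      (fun i => ae_of_ae_map (hpair _ _).aemeasurable (hpos' i))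
      (fun i => (integrable_map_measure hlogm.aestronglyMeasurable
        (hpair _ _).aemeasurable).1 (hint' i)) (hE u) hM1
  -- A queue with a single packet that arrives at time `0`.
  have hnone : 0 ≤ ∫ x, -Real.log (r x.1 x.2).toReal ∂(inOutLaw ν (waitLaw ν (ρ' none))) := by
    have hlaw0 : inOutLaw ν (waitLaw ν (ρ' none)) = (Measure.pi fun _ : Fin 1 => ν).map
        fun s => (idleTime 0 s 0, interdeparture 0 s 0) := by
      rw [map_idleTime_interdeparture]
      simp [ρ', waitLaw_dirac_zero hnonneg, idleTime, departureTime]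
    have hpos' := hpos none
    have hint' := hint none
    rw [hlaw0] at hpos' hint' ⊢
    have := log_mul_measureReal_le hr hle (0 : Fin 1 → ℝ)
      (fun i => Subsingleton.elim 0 i ▸ ae_of_ae_map (hpair _ _).aemeasurable hpos')
      (fun i => Subsingleton.elim 0 i ▸ (integrable_map_measure hlogm.aestronglyMeasurable
        (hpair _ _).aemeasurable).1 hint') MeasurableSet.empty le_rfl
    rw [integral_map (hpair _ _).aemeasurable hlogm.aestronglyMeasurable]
    simpa using this
  have hQ : ∑ u, (Measure.pi fun _ : Fin n => η).real {y | c.decoder (partialSums y) = u} = 1 := by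
    have := sum_measureReal_preimage_singleton (μ := Measure.pi fun _ : Fin n => η)
      (f := fun y => c.decoder (partialSums y)) Finset.univ (fun u _ => hE u)
    simp only [Finset.coe_univ, Set.preimage_univ, probReal_univ] at this
    exact this
  have hinfo' : (channelInfo ν (∑ j, p j • waitLaw ν (ρ' j))).toReal
      ≤ (supInfoNoFeedback model ν a).toReal * Real.log 2 := by
    refine (ENNReal.toReal_mono (ENNReal.mul_ne_top htop ENNReal.ofReal_ne_top) hinfo).trans_eq ?_
    rw [ENNReal.toReal_mul, ENNReal.toReal_ofReal hlog2.le]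
  have hsome : a / (M * n * b) * ∑ u, ∑ i, ∫ x, -Real.log (r x.1 x.2).toReal
        ∂(inOutLaw ν (waitLaw ν (ρ' (some (u, i)))))
      ≤ (supInfoNoFeedback model ν a).toReal * Real.log 2 := by
    refine le_trans ?_ hinfo'
    rw [← hval, Fintype.sum_option, Fintype.sum_prod_type]
    have hθ : ∀ j, (p (some j)).toReal = a / (M * n * b) := fun j =>
      ENNReal.toReal_ofReal (by positivity)
    simp only [hθ, ← Finset.mul_sum]
    exact le_add_of_nonneg_left (mul_nonneg ENNReal.toReal_nonneg hnone)
  have hsum := Finset.sum_le_sum fun u (_ : u ∈ Finset.univ) => hmessage u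
  rw [← Finset.mul_sum, Finset.sum_add_distrib, ← Finset.mul_sum, hQ] at hsum
  have hscale : ∑ u, ∑ i, ∫ x, -Real.log (r x.1 x.2).toReal
        ∂(inOutLaw ν (waitLaw ν (ρ' (some (u, i)))))
      ≤ M * n * (b / a) * ((supInfoNoFeedback model ν a).toReal * Real.log 2) := by
    rw [div_mul_eq_mul_div, div_le_iff₀ (by positivity)] at hsome
    rw [mul_div_assoc', div_mul_eq_mul_div, le_div_iff₀ ha]
    linarith
  linarith

/-! ### A preliminary packet at time `0` -/

/-- The code with one more packet, which arrives at time `0`, and with all the codewords delayed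
by `m`. The decoder ignores the departure of the preliminary packet. -/
noncomputable def TimingCode.prepend {model : TimeModel} {n M : ℕ} (c : TimingCode model n M)
    (m : ℕ) : TimingCode model (n + 1) M where
  arrival u := Fin.cons 0 fun i => c.arrival u i + m
  arrival_nonneg u i := by
    refine Fin.cases ?_ (fun i => ?_) i
    · simp
    · simpa using add_nonneg (c.arrival_nonneg u i) m.cast_nonneg
  arrival_mem_times u i := by
    refine Fin.cases ?_ (fun i => ?_) i
    · simpa using model.zero_mem_times
    · simpa using TimeModel.add_mem_times (c.arrival_mem_times u i) (model.natCast_mem_times m)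
  arrival_mono u := by
    refine fun i j => Fin.cases (fun _ => ?_) (fun i hij => ?_) i
    · refine Fin.cases ?_ (fun j => ?_) j
      · simp
      · simpa using add_nonneg (c.arrival_nonneg u j) m.cast_nonneg
    · revert hij
      refine Fin.cases (fun hij => ?_) (fun j hij => ?_) j
      · exact absurd hij (by simp)
      · simpa using c.arrival_mono u (Fin.succ_le_succ_iff.1 hij)
  decoder y := c.decoder fun i => y i.succ - m
  measurable_decoder := c.measurable_decoder.comp (by fun_prop)

lemma departureTime_cons_add_two {n : ℕ} (a : Fin n → ℝ) (s : Fin (n + 1) → ℝ) (m : ℝ)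
    (i : Fin n) :
    departureTime (Fin.cons 0 fun i => a i + m) s (i + 2)
      = max (a i + m) (departureTime (Fin.cons 0 fun i => a i + m) s (i + 1))
        + Fin.tail s i := by
  simpa [Fin.tail] using departureTime_succ_of_lt (Fin.cons 0 fun i => a i + m) s i.succ

lemma departureTime_cons_le {n : ℕ} (a : Fin n → ℝ) {s : Fin (n + 1) → ℝ} {m : ℝ} (hm : 0 ≤ m)
    (hs : 0 ≤ s 0) {k : ℕ} (hk : k ≤ n) :
    departureTime (Fin.cons 0 fun i => a i + m) s (k + 1)
      ≤ departureTime a (Fin.tail s) k + m + s 0 := by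
  induction k with
  | zero => simp [departureTime, hm]
  | succ k ih =>
    have h1 := departureTime_cons_add_two a s m ⟨k, hk⟩
    have h2 := departureTime_succ_of_lt a (Fin.tail s) ⟨k, hk⟩
    have ih' := ih (by omega)
    simp only at h1 h2
    rw [h1, h2]
    have h3 := le_max_left (a ⟨k, hk⟩) (departureTime a (Fin.tail s) k)
    have h4 := le_max_right (a ⟨k, hk⟩) (departureTime a (Fin.tail s) k)
    have : max (a ⟨k, hk⟩ + m) (departureTime (Fin.cons 0 fun i => a i + m) s (k + 1))
        ≤ max (a ⟨k, hk⟩) (departureTime a (Fin.tail s) k) + m + s 0 :=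
      max_le (by linarith) (by linarith)
    linarith

/-- If the preliminary packet leaves before the delay `m` has elapsed, then it does not disturb the
transmission. -/
lemma departures_cons_succ {n : ℕ} {a : Fin n → ℝ} (ha : ∀ i, 0 ≤ a i) {s : Fin (n + 1) → ℝ}
    {m : ℝ} (hs : s 0 ≤ m) (i : Fin n) :
    departures (Fin.cons 0 fun i => a i + m) s i.succ = departures a (Fin.tail s) i + m := by
  suffices h : ∀ k (hk : k < n), departureTime (Fin.cons 0 fun i => a i + m) s (k + 2)
      = departureTime a (Fin.tail s) (k + 1) + m from h i i.2
  intro k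
  induction k with
  | zero =>
    intro hk
    have h1 := departureTime_cons_add_two a s m ⟨0, hk⟩
    have h2 := departureTime_succ_of_lt a (Fin.tail s) ⟨0, hk⟩
    have h3 : departureTime (Fin.cons 0 fun i => a i + m) s (0 + 1) = s 0 := by
      simp [departureTime]
    simp only at h1 h2
    have h4 : departureTime a (Fin.tail s) 0 = 0 := rfl
    have h5 := ha ⟨0, hk⟩
    rw [h1, h2, h3, h4, max_eq_left h5, max_eq_left (by linarith)]
    ring
  | succ k ih =>
    intro hk
    have h1 := departureTime_cons_add_two a s m ⟨k + 1, hk⟩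
    have h2 := departureTime_succ_of_lt a (Fin.tail s) ⟨k + 1, hk⟩
    simp only at h1 h2
    rw [h1, h2, ih (by omega), max_add_add_right]
    ring

lemma measurePreserving_tail {ν : Measure ℝ} [IsProbabilityMeasure ν] (n : ℕ) :
    MeasurePreserving (Fin.tail : (Fin (n + 1) → ℝ) → Fin n → ℝ)
      (Measure.pi fun _ => ν) (Measure.pi fun _ => ν) :=
  measurePreserving_snd.comp (measurePreserving_piFinSuccAbove (fun _ : Fin (n + 1) => ν) 0)

lemma sum_lintegral_idleTime_add {ν : Measure ℝ} [IsProbabilityMeasure ν]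
    (hnonneg : ∀ᵐ s ∂ν, 0 ≤ s) {n : ℕ} (a : Fin n → ℝ) :
    ∑ i, ∫⁻ s, ENNReal.ofReal (idleTime a s i) ∂(Measure.pi fun _ : Fin n => ν)
        + n * ∫⁻ s, ENNReal.ofReal s ∂ν
      = ∫⁻ s, ENNReal.ofReal (departureTime a s n) ∂(Measure.pi fun _ : Fin n => ν) := by
  have hall : ∀ᵐ s ∂(Measure.pi fun _ : Fin n => ν), ∀ i, 0 ≤ s i :=
    ae_all_iff.2 fun i => (measurePreserving_eval (fun _ : Fin n => ν)
      i).quasiMeasurePreserving.ae hnonneg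
  have hrw : ∀ᵐ s ∂(Measure.pi fun _ : Fin n => ν), ENNReal.ofReal (departureTime a s n)
      = ∑ i, (ENNReal.ofReal (idleTime a s i) + ENNReal.ofReal (s i)) := by
    filter_upwards [hall] with s hs
    rw [departureTime_last_eq_sum, ENNReal.ofReal_sum_of_nonneg
      fun i _ => add_nonneg (idleTime_nonneg a s i) (hs i)]
    exact Finset.sum_congr rfl fun i _ => ENNReal.ofReal_add (idleTime_nonneg a s i) (hs i)
  have hservice : ∀ i, ∫⁻ s : Fin n → ℝ, ENNReal.ofReal (s i) ∂(Measure.pi fun _ : Fin n => ν)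
      = ∫⁻ s, ENNReal.ofReal s ∂ν := fun i =>
    (measurePreserving_eval (fun _ : Fin n => ν) i).lintegral_comp (f := ENNReal.ofReal)
      (by fun_prop)
  rw [lintegral_congr_ae hrw, lintegral_finsetSum _ fun i _ => by fun_prop]
  have hsplit : ∀ i, ∫⁻ s : Fin n → ℝ, (ENNReal.ofReal (idleTime a s i) + ENNReal.ofReal (s i))
        ∂(Measure.pi fun _ : Fin n => ν)
      = ∫⁻ s, ENNReal.ofReal (idleTime a s i) ∂(Measure.pi fun _ : Fin n => ν)
        + ∫⁻ s, ENNReal.ofReal s ∂ν := fun i => by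
    rw [lintegral_add_left (by fun_prop), hservice]
  simp only [hsplit, Finset.sum_add_distrib]
  simp

/-! ### The converse for one code -/

/-- The total idle time is the last departure time minus the total service time. The preliminary
packet adds at most its own service time and the delay `m` to the last departure time. -/
lemma TimingCode.sum_lintegral_idleTime_prepend_le {model : TimeModel} {ν : Measure ℝ} {mu : ℝ}
    (hmu : 0 < mu) (hν : IsServiceLaw model mu ν) {n M : ℕ} (hM : 0 < M)
    (c : TimingCode model n M) (m : ℕ) {T b : ℝ} (hT : 0 ≤ T) (hb : 0 ≤ b)
    (hmean : c.meanLastDeparture ν ≤ ENNReal.ofReal T) (hTb : T + m ≤ n / mu + (n + 1) * b) :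
    ∑ u, ∑ i, ∫⁻ s, ENNReal.ofReal (idleTime ((c.prepend m).arrival u) s i)
      ∂(Measure.pi fun _ : Fin (n + 1) => ν) ≤ ENNReal.ofReal (M * (n + 1 : ℕ) * b) := by
  have := hν.isProbability
  have hM' : (0 : ℝ) < M := by exact_mod_cast hM
  have hlast : ∀ u, ∫⁻ s, ENNReal.ofReal (departureTime ((c.prepend m).arrival u) s (n + 1))
        ∂(Measure.pi fun _ : Fin (n + 1) => ν)
      ≤ ∫⁻ s, ENNReal.ofReal (departureTime (c.arrival u) s n) ∂(Measure.pi fun _ : Fin n => ν)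
        + (ENNReal.ofReal m + ENNReal.ofReal (1 / mu)) := by
    intro u
    have hs0 : ∀ᵐ s ∂(Measure.pi fun _ : Fin (n + 1) => ν), 0 ≤ s 0 :=
      (measurePreserving_eval (fun _ : Fin (n + 1) => ν) 0).quasiMeasurePreserving.ae hν.nonneg
    have hint0 : ∫⁻ s : Fin (n + 1) → ℝ, ENNReal.ofReal (s 0)
        ∂(Measure.pi fun _ : Fin (n + 1) => ν) = ENNReal.ofReal (1 / mu) := by
      rw [← hν.mean]
      exact (measurePreserving_eval (fun _ : Fin (n + 1) => ν) 0).lintegral_comp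
        (f := ENNReal.ofReal) (by fun_prop)
    have hint1 : ∫⁻ s, ENNReal.ofReal (departureTime (c.arrival u) (Fin.tail s) n)
        ∂(Measure.pi fun _ : Fin (n + 1) => ν)
        = ∫⁻ s, ENNReal.ofReal (departureTime (c.arrival u) s n)
          ∂(Measure.pi fun _ : Fin n => ν) :=
      (measurePreserving_tail n).lintegral_comp
        (f := fun s => ENNReal.ofReal (departureTime (c.arrival u) s n)) (by fun_prop)
    have hm1 : Measurable fun s : Fin (n + 1) → ℝ =>
        ENNReal.ofReal (departureTime (c.arrival u) (Fin.tail s) n) :=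
      (by fun_prop : Measurable fun s => ENNReal.ofReal (departureTime (c.arrival u) s n)).comp
        (measurePreserving_tail (ν := ν) n).measurable
    have hconst : ENNReal.ofReal m + ∫⁻ s : Fin (n + 1) → ℝ, ENNReal.ofReal (s 0)
          ∂(Measure.pi fun _ : Fin (n + 1) => ν)
        = ∫⁻ s : Fin (n + 1) → ℝ, (ENNReal.ofReal m + ENNReal.ofReal (s 0))
          ∂(Measure.pi fun _ : Fin (n + 1) => ν) := by
      rw [lintegral_add_left measurable_const]
      simp
    rw [← hint0, ← hint1, hconst, ← lintegral_add_left hm1]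
    refine lintegral_mono_ae ?_
    filter_upwards [hs0] with s hs
    rw [← ENNReal.ofReal_add m.cast_nonneg hs]
    refine le_trans (ENNReal.ofReal_le_ofReal ?_) ENNReal.ofReal_add_le
    have := departureTime_cons_le (c.arrival u) (m := m) m.cast_nonneg hs le_rfl
    rw [← add_assoc]
    exact this
  have hsum : ∑ u, ∫⁻ s, ENNReal.ofReal (departureTime (c.arrival u) s n)
      ∂(Measure.pi fun _ : Fin n => ν) ≤ ENNReal.ofReal T * M := by
    rw [TimingCode.meanLastDeparture] at hmean
    exact (ENNReal.div_le_iff (by exact_mod_cast hM.ne') (ENNReal.natCast_ne_top M)).1 hmean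
  have htop : (M : ℝ≥0∞) * ((n + 1 : ℕ) * ENNReal.ofReal (1 / mu)) ≠ ∞ :=
    ENNReal.mul_ne_top (ENNReal.natCast_ne_top M)
      (ENNReal.mul_ne_top (ENNReal.natCast_ne_top _) ENNReal.ofReal_ne_top)
  refine (ENNReal.add_le_add_iff_right htop).1 ?_
  calc _ = ∑ u, ∫⁻ s, ENNReal.ofReal (departureTime ((c.prepend m).arrival u) s (n + 1))
        ∂(Measure.pi fun _ : Fin (n + 1) => ν) := by
        simp only [← sum_lintegral_idleTime_add hν.nonneg, hν.mean, Finset.sum_add_distrib,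
          Finset.sum_const, Finset.card_univ, Fintype.card_fin, nsmul_eq_mul]
    _ ≤ ENNReal.ofReal T * M + M * (ENNReal.ofReal m + ENNReal.ofReal (1 / mu)) := by
        refine (Finset.sum_le_sum fun u _ => hlast u).trans ?_
        rw [Finset.sum_add_distrib, Finset.sum_const, Finset.card_univ, Fintype.card_fin,
          nsmul_eq_mul]
        exact add_le_add hsum le_rfl
    _ = ENNReal.ofReal (T * M + M * (m + 1 / mu)) := by
        rw [ENNReal.ofReal_add (by positivity) (by positivity), ENNReal.ofReal_mul hT,
          ENNReal.ofReal_mul hM'.le, ENNReal.ofReal_add (by positivity) (by positivity),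
          ENNReal.ofReal_natCast M]
    _ ≤ ENNReal.ofReal (M * (n + 1 : ℕ) * b + M * ((n + 1 : ℕ) * (1 / mu))) := by
        refine ENNReal.ofReal_le_ofReal ?_
        have h := mul_le_mul_of_nonneg_left hTb hM'.le
        push_cast
        have h2 : (n : ℝ) / mu = n * (1 / mu) := by ring
        rw [h2] at h
        linarith
    _ = _ := by
        rw [ENNReal.ofReal_add (by positivity) (by positivity),
          ENNReal.ofReal_mul (q := _ * (1 / mu)) hM'.le,
          ENNReal.ofReal_mul (q := 1 / mu) (by positivity), ENNReal.ofReal_natCast M,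
          ENNReal.ofReal_natCast (n + 1)]

lemma TimingCode.measurableSet_correct {model : TimeModel} {n M : ℕ} (c : TimingCode model n M)
    (u : Fin M) : MeasurableSet {s | c.decoder (departures (c.arrival u) s) = u} := by
  simp only [departures_eq_partialSums]
  exact (c.measurable_decoder.comp (measurable_partialSums.comp
    (measurable_interdeparture _))) (measurableSet_singleton u)

/-- The preliminary packet spoils a correct decoding only if its service exceeds the delay `m`. -/
lemma TimingCode.correct_prepend_ge {model : TimeModel} {ν : Measure ℝ} [IsProbabilityMeasure ν]
    {n M : ℕ} (c : TimingCode model n M) (m : ℕ) (u : Fin M) :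
    (Measure.pi fun _ : Fin n => ν).real {s | c.decoder (departures (c.arrival u) s) = u}
        - ν.real (Set.Ioi m)
      ≤ (Measure.pi fun _ : Fin (n + 1) => ν).real
        {s | (c.prepend m).decoder (departures ((c.prepend m).arrival u) s) = u} := by
  have h1 : (Measure.pi fun _ : Fin n => ν).real {s | c.decoder (departures (c.arrival u) s) = u}
      = (Measure.pi fun _ : Fin (n + 1) => ν).real
        (Fin.tail ⁻¹' {s | c.decoder (departures (c.arrival u) s) = u}) := by
    rw [measureReal_def, measureReal_def,
      (measurePreserving_tail n).measure_preimage (c.measurableSet_correct u).nullMeasurableSet]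
  have h2 : ν.real (Set.Ioi m) = (Measure.pi fun _ : Fin (n + 1) => ν).real
      ((fun s => s 0) ⁻¹' Set.Ioi (m : ℝ)) := by
    rw [measureReal_def, measureReal_def]
    congr 1
    exact ((measurePreserving_eval (fun _ : Fin (n + 1) => ν) 0).measure_preimage
      measurableSet_Ioi.nullMeasurableSet).symm
  rw [h1, h2, sub_le_iff_le_add]
  refine (measureReal_mono fun s hs => ?_).trans (measureReal_union_le _ _)
  by_cases h : s 0 ≤ m
  · left
    have : (fun i : Fin n => departures ((c.prepend m).arrival u) s i.succ - m)
        = departures (c.arrival u) (Fin.tail s) := by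
      funext i
      have := departures_cons_succ (c.arrival_nonneg u) h i
      simp only [TimingCode.prepend, this, add_sub_cancel_right]
    change c.decoder (fun i : Fin n => departures ((c.prepend m).arrival u) s i.succ - m) = u
    rw [this]
    exact hs
  · right
    exact not_le.1 h

lemma TimingCode.le_sum_correct {model : TimeModel} {ν : Measure ℝ} [IsProbabilityMeasure ν]
    {n M : ℕ} (hM : 0 < M) (c : TimingCode model n M) {ε : ℝ} (hε : c.errorProb ν ≤ ε) :
    M * (1 - ε) ≤ ∑ u, (Measure.pi fun _ : Fin n => ν).real
      {s | c.decoder (departures (c.arrival u) s) = u} := by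
  have hM' : (0 : ℝ) < M := by exact_mod_cast hM
  rw [TimingCode.errorProb, div_le_iff₀ hM'] at hε
  have h : ∀ u, (Measure.pi fun _ : Fin n => ν).real
      {s | c.decoder (departures (c.arrival u) s) ≠ u}
      = 1 - (Measure.pi fun _ : Fin n => ν).real
      {s | c.decoder (departures (c.arrival u) s) = u} := fun u =>
    probReal_compl_eq_one_sub (c.measurableSet_correct u)
  simp only [h, Finset.sum_sub_distrib, Finset.sum_const, Finset.card_univ, Fintype.card_fin,
    nsmul_eq_mul, mul_one] at hε
  linarith

/-- The weak converse for a code of finite length. -/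
lemma TimingCode.log_mul_le {model : TimeModel} {ν : Measure ℝ} {mu : ℝ} (hmu : 0 < mu)
    (hν : IsServiceLaw model mu ν) {n M : ℕ} (c : TimingCode model n M) (m : ℕ) {T ε a b : ℝ}
    (hT : 0 ≤ T) (hcode : c.IsCode ν T ε) (ha : 0 < a) (hab : a < b)
    (hTb : T + m ≤ n / mu + (n + 1) * b) (htop : supInfoNoFeedback model ν a ≠ ∞) :
    Real.log M * (1 - ε - ν.real (Set.Ioi m))
      ≤ (n + 1) * (b / a) * ((supInfoNoFeedback model ν a).toReal * Real.log 2) + 1 := by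
  have := hν.isProbability
  have hM : 0 < M := Fin.pos (c.decoder 0)
  have hM' : (0 : ℝ) < M := by exact_mod_cast hM
  have hlog : 0 ≤ Real.log M := Real.log_natCast_nonneg M
  have h1 := log_mul_sum_le hν.nonneg hν.mem_times n.succ_pos hM (c.prepend m)
    (fun u i hi => by
      have : i = 0 := Fin.ext hi
      subst this
      rfl) ha hab
    (c.sum_lintegral_idleTime_prepend_le hmu hν hM m hT (ha.trans hab).le hcode.1 hTb) htop
  have h2 := c.le_sum_correct hM hcode.2
  have h3 := Finset.sum_le_sum fun u (_ : u ∈ Finset.univ) => c.correct_prepend_ge (ν := ν) m u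
  simp only [Finset.sum_sub_distrib, Finset.sum_const, Finset.card_univ, Fintype.card_fin,
    nsmul_eq_mul] at h3
  have h4 : (M : ℝ) * (1 - ε - ν.real (Set.Ioi m)) ≤ _ := le_trans (by linarith) h3
  have h5 := (mul_le_mul_of_nonneg_left h4 hlog).trans h1
  refine le_of_mul_le_mul_left ?_ hM'
  push_cast at h5
  linarith

/-! ### Long codes -/

lemma tendsto_measureReal_Ioi_natCast (ν : Measure ℝ) [IsProbabilityMeasure ν] :
    Tendsto (fun m : ℕ => ν.real (Set.Ioi (m : ℝ))) atTop (𝓝 0) := by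
  have h := tendsto_measure_iInter_atTop (μ := ν) (s := fun m : ℕ => Set.Ioi (m : ℝ))
    (fun m => measurableSet_Ioi.nullMeasurableSet)
    (fun i j hij => Set.Ioi_subset_Ioi (by exact_mod_cast hij)) ⟨0, measure_ne_top _ _⟩
  have hempty : ⋂ m : ℕ, Set.Ioi (m : ℝ) = ∅ := by
    refine Set.eq_empty_of_forall_notMem fun x hx => ?_
    obtain ⟨m, hm⟩ := exists_nat_gt x
    exact absurd (Set.mem_iInter.1 hx m) (not_lt.2 hm.le)
  rw [hempty, measure_empty] at h
  exact (ENNReal.tendsto_toReal ENNReal.zero_ne_top).comp h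

lemma tendsto_natSqrt_atTop : Tendsto Nat.sqrt atTop atTop :=
  tendsto_atTop_atTop.2 fun k => ⟨k * k, fun _ hn => Nat.le_sqrt.2 hn⟩

lemma tendsto_natSqrt_div : Tendsto (fun n : ℕ => (Nat.sqrt n : ℝ) / n) atTop (𝓝 0) := by
  have h : Tendsto (fun n : ℕ => ((Nat.sqrt n : ℝ))⁻¹) atTop (𝓝 0) :=
    (tendsto_inv_atTop_zero.comp tendsto_natCast_atTop_atTop).comp tendsto_natSqrt_atTop
  refine squeeze_zero (fun n => by positivity) (fun n => ?_) h
  rcases Nat.eq_zero_or_pos n with rfl | hn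
  · simp
  · have h1 : (0 : ℝ) < Nat.sqrt n := by exact_mod_cast Nat.sqrt_pos.2 hn
    have h2 : (Nat.sqrt n : ℝ) * Nat.sqrt n ≤ n := by exact_mod_cast Nat.sqrt_le n
    rw [div_le_iff₀ (by exact_mod_cast hn), inv_mul_eq_div, le_div_iff₀ h1]
    exact h2

/-- The delay `m = √n` grows slowly enough not to change the rate, and makes the error added by the
preliminary packet vanish. The excess `b - a` of the mean idle time tends to `0` as well. -/
lemma le_of_isAchievableAt {model : TimeModel} {ν : Measure ℝ} {mu lam R : ℝ} (hmu : 0 < mu)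
    (hν : IsServiceLaw model mu ν) (hlam : 0 < lam) (hlt : lam < mu)
    (htop : supInfoNoFeedback model ν (1 / lam - 1 / mu) ≠ ∞)
    (hR : IsAchievableAt model ν lam R) :
    R ≤ lam * (supInfoNoFeedback model ν (1 / lam - 1 / mu)).toReal := by
  have := hν.isProbability
  set a := 1 / lam - 1 / mu with ha_def
  have ha : 0 < a := sub_pos.2 (one_div_lt_one_div_of_lt hlam hlt)
  set Φ := (supInfoNoFeedback model ν a).toReal
  have hΦ : 0 ≤ Φ := ENNReal.toReal_nonneg
  have hlog2 : 0 < Real.log 2 := Real.log_pos one_lt_two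
  refine le_of_forall_pos_le_add fun γ hγ => ?_
  obtain ⟨n, M, ε, c, hn, hε, hc⟩ := hR γ hγ
  rcases le_or_gt (R - γ) 0 with hneg | hpos
  · have := mul_nonneg hlam.le hΦ
    linarith
  suffices h : R - γ ≤ lam * Φ by linarith
  have hδ := (tendsto_measureReal_Ioi_natCast ν).comp (tendsto_natSqrt_atTop.comp hn)
  have hinv : Tendsto (fun k => ((n k : ℝ))⁻¹) atTop (𝓝 0) :=
    tendsto_inv_atTop_zero.comp (tendsto_natCast_atTop_atTop.comp hn)
  have hsqrt := tendsto_natSqrt_div.comp hn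
  have hleft : Tendsto (fun k => (R - γ) * (1 - ε k - ν.real (Set.Ioi (Nat.sqrt (n k) : ℝ))))
      atTop (𝓝 (R - γ)) := by
    simpa using ((hε.const_sub 1).sub hδ).const_mul (R - γ)
  have hright : Tendsto (fun k => lam * ((1 + (n k : ℝ)⁻¹
      + ((Nat.sqrt (n k) : ℝ) / n k + (n k : ℝ)⁻¹) / a) * Φ + (n k : ℝ)⁻¹ / Real.log 2))
      atTop (𝓝 (lam * Φ)) := by
    have h1 := (((hinv.const_add 1).add ((hsqrt.add hinv).div_const a)).mul_const Φ).add
      (hinv.div_const (Real.log 2))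
    simpa using h1.const_mul lam
  refine le_of_tendsto_of_tendsto hleft hright ?_
  have hfactor : ∀ᶠ k in atTop, 0 < 1 - ε k - ν.real (Set.Ioi (Nat.sqrt (n k) : ℝ)) := by
    have h1 : Tendsto (fun k => 1 - ε k - ν.real (Set.Ioi (Nat.sqrt (n k) : ℝ))) atTop (𝓝 1) := by
      simpa using (hε.const_sub 1).sub hδ
    exact h1.eventually (lt_mem_nhds one_pos)
  filter_upwards [hfactor, hn.eventually_gt_atTop 0] with k hk hnk
  obtain ⟨hcode, hrate⟩ := hc k
  have hnk' : (0 : ℝ) < n k := by exact_mod_cast hnk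
  set m := Nat.sqrt (n k)
  have h1 := (c k).log_mul_le hmu hν m (a := a) (b := a + (m + 1) / (n k + 1))
    (by positivity) hcode ha (lt_add_of_pos_right _ (by positivity)) (by
      have h2 : ((n k : ℝ) + 1) * (a + (m + 1) / (n k + 1)) = (n k + 1) * a + (m + 1) := by
        field_simp
      have h3 : (n k : ℝ) / lam = n k / mu + n k * a := by
        rw [ha_def]
        ring
      rw [h2, h3]
      linarith) htop
  have h4 : ((n k : ℝ) + 1) * ((a + (m + 1) / (n k + 1)) / a) = n k + 1 + (m + 1) / a := by
    field_simp
  rw [h4] at h1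
  have h5 : (R - γ) * (n k * Real.log 2 / lam) ≤ Real.log (M k) := by
    have h6 : lam * (Real.logb 2 (M k) / n k) * (n k * Real.log 2 / lam) = Real.log (M k) := by
      rw [Real.logb]
      field_simp
    rw [← h6]
    exact mul_le_mul_of_nonneg_right hrate.le (by positivity)
  have h7 := (mul_le_mul_of_nonneg_right h5 hk.le).trans h1
  have h8 : lam * ((1 + (n k : ℝ)⁻¹ + ((m : ℝ) / n k + (n k : ℝ)⁻¹) / a) * Φ
        + (n k : ℝ)⁻¹ / Real.log 2)
      = ((n k + 1 + (m + 1) / a) * (Φ * Real.log 2) + 1) / (n k * Real.log 2 / lam) := by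
    field_simp
  rw [h8, le_div_iff₀ (by positivity)]
  linarith

/-! ### Comparison with feedback -/

lemma supInfoNoFeedback_le_supInfoFeedback {model : TimeModel} {ν : Measure ℝ}
    [IsProbabilityMeasure ν] (hmem : ∀ᵐ s ∂ν, s ∈ model.times) (a : ℝ) :
    supInfoNoFeedback model ν a ≤ supInfoFeedback model ν a := by
  refine iSup_le fun ρ => iSup_le fun hρ => iSup_le fun hρmem => iSup_le fun hmean => ?_
  rw [infoNoFeedback_eq, ← mutualInfo_fst_add]
  refine le_iSup_of_le (waitLaw ν ρ) <| le_iSup_of_le inferInstance <| le_iSup_of_le ?_ <|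
    le_iSup_of_le ?_ <| le_iSup_of_le (by rwa [← meanWait_eq]) le_rfl
  · refine (ae_map_iff (p := fun x => x ∈ model.times) (by fun_prop)
      model.measurableSet_times).2 ?_
    have h1 : ∀ᵐ q ∂(ρ.prod ν), q.1 ∈ model.times :=
      measurePreserving_fst.quasiMeasurePreserving.ae hρmem
    have h2 : ∀ᵐ q ∂(ρ.prod ν), q.2 ∈ model.times :=
      measurePreserving_snd.quasiMeasurePreserving.ae hmem
    filter_upwards [h1, h2] with q hq1 hq2
    exact TimeModel.max_mem_times (TimeModel.sub_mem_times hq1 hq2) model.zero_mem_times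
  · exact (ae_map_iff (by fun_prop) measurableSet_Ici).2 (ae_of_all _ fun q => le_max_right _ _)

theorem corollary3p3 (model : TimeModel) (ν : Measure ℝ) (mu lam : ℝ) (hmu : 0 < mu)
    (hν : IsServiceLaw model mu ν) (hlam : 0 < lam) (hlt : lam < mu) :
    capacityAt model ν lam
        ≤ ENNReal.ofReal lam * supInfoNoFeedback model ν (1 / lam - 1 / mu) ∧
      ENNReal.ofReal lam * supInfoNoFeedback model ν (1 / lam - 1 / mu)
        ≤ ENNReal.ofReal lam * supInfoFeedback model ν (1 / lam - 1 / mu) := by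
  have := hν.isProbability
  refine ⟨?_, by gcongr; exact supInfoNoFeedback_le_supInfoFeedback hν.mem_times _⟩
  by_cases htop : supInfoNoFeedback model ν (1 / lam - 1 / mu) = ∞
  · rw [htop, ENNReal.mul_top (by simpa using hlam)]
    exact le_top
  · refine iSup_le fun R => iSup_le fun hR => ?_
    rw [← ENNReal.ofReal_toReal htop, ← ENNReal.ofReal_mul hlam.le]
    exact ENNReal.ofReal_le_ofReal (le_of_isAchievableAt hmu hν hlam hlt htop hR)
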